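/- Let $d\ge 1$ and let $\theta_i=(w_i,b_i),\ \theta_j=(w_j,b_j)\in\mathbb{R}^d\times\mathbb{R}$. For an activation $\sigma:\mathbb{R}\to\mathbb{R}$, a measure $\mu$ on a space $\mathbb{X}$ and a sufficient statistic $t:\mathbb{X}\to\mathbb{R}^d$, write $$k_{\sigma,t,\mu}(\theta_i,\theta_j)=\int_{\mathbb{X}}\sigma\big(w_i^\top t(x)+b_i\big)\,\sigma\big(w_j^\top t(x)+b_j\big)\,\mu(dx).$$ Let $\Phi$ be the standard Gaussian measure on $\mathbb{R}^d$, let $\mathrm{proj}(x)=x/\|x\|$ for $x\ne 0$ (with $\mathrm{proj}(0)=0$, say), let $\nu$ be the uniform probability measure on the unit sphere $S^{d-1}\subset\mathbb{R}^d$, and let $\mathrm{Id}$ be the inclusion $S^{d-1}\hookrightarrow\mathbb{R}^d$. Let $$I_p(z)=\sum_{k\ge 0}\frac{(z/2)^{2k+p}}{k!\,\Gamma(k+p+1)}\qquad (z>0)$$ be the modified Bessel function of the first kind of order $p$. Then the image of $\Phi$ under $\mathrm{proj}$ is $\nu$ (as a measure on $\mathbb{R}^d$), the integrals defining $k_{\exp,\mathrm{proj},\Phi}$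 and $k_{\exp,\mathrm{Id},\nu}$ converge, and $$k_{\exp,\mathrm{proj},\Phi}(\theta_i,\theta_j)=k_{\exp,\mathrm{Id},\nu}(\theta_i,\theta_j)=\exp(b_i+b_j)\,\frac{\Gamma(d/2)\,2^{d/2-1}\,I_{d/2-1}(\|w_i+w_j\|)}{\|w_i+w_j\|^{d/2-1}}\qquad\text{if } w_i+w_j\neq 0.$$ If $w_i+w_j=0$, both kernels equal $\exp(b_i+b_j)$, which is the limit of $\exp(b_i+b_j)\,\Gamma(d/2)\,2^{d/2-1}I_{d/2-1}(r)/r^{d/2-1}$ as $r\to 0^+$. For $d=3$ and $w_i+w_j\ne 0$, $$k_{\exp,\mathrm{proj},\Phi}(\theta_i,\theta_j)=\exp(b_i+b_j)\,\frac{\sinh(\|w_i+w_j\|)}{\|w_i+w_j\|}.$$ -/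

import Mathlib

open MeasureTheory ProbabilityTheory Filter
open scoped Topology

noncomputable section

/-- A neuron's parameter `θ = (w, b)`: a weight vector in `ℝ^d` and a scalar bias. -/
abbrev NeuronParam (d : ℕ) : Type := EuclideanSpace ℝ (Fin d) × ℝ

/-- The integrand `σ(w_i^⊤ t(x) + b_i) σ(w_j^⊤ t(x) + b_j)` of the neural network kernel. -/
def nnkIntegrand {X : Type*} {d : ℕ} (σ : ℝ → ℝ) (t : X → EuclideanSpace ℝ (Fin d))
    (θi θj : NeuronParam d) (x : X) : ℝ :=
  σ (inner ℝ θi.1 (t x) + θi.2) * σ (inner ℝ θj.1 (t x) + θj.2)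

/-- The neural network kernel `k_{σ,t,μ}(θ_i, θ_j)` with activation `σ`, sufficient statistic `t`
and base measure `μ`. -/
def nnKernel {X : Type*} [MeasurableSpace X] {d : ℕ} (σ : ℝ → ℝ)
    (t : X → EuclideanSpace ℝ (Fin d)) (μ : Measure X) (θi θj : NeuronParam d) : ℝ :=
  ∫ x, nnkIntegrand σ t θi θj x ∂μ

/-- The projection `x ↦ x / ‖x‖` onto the unit sphere (its value at `0`, a Gaussian null set
in positive dimension, is `0`). -/
def sphereProj (d : ℕ) (x : EuclideanSpace ℝ (Fin d)) : EuclideanSpace ℝ (Fin d) :=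
  ‖x‖⁻¹ • x

/-- The uniform probability measure on the unit sphere `S^{d-1}` of `ℝ^d` (`1 ≤ d`): the surface
measure divided by its total mass. -/
def uniformSphere (d : ℕ) : Measure (Metric.sphere (0 : EuclideanSpace ℝ (Fin d)) 1) :=
  ((volume : Measure (EuclideanSpace ℝ (Fin d))).toSphere Set.univ)⁻¹ •
    (volume : Measure (EuclideanSpace ℝ (Fin d))).toSphere

/-- The modified Bessel function of the first kind of real order `p`, at `z > 0`:
`I_p(z) = ∑_{k ≥ 0} (z/2)^(2k+p) / (k! Γ(k+p+1))`. -/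
def besselI (p z : ℝ) : ℝ :=
  ∑' k : ℕ, (z / 2) ^ (2 * (k : ℝ) + p) / ((k.factorial : ℝ) * Real.Gamma ((k : ℝ) + p + 1))

/-- `Γ(d/2) 2^(d/2-1) I_{d/2-1}(r) / r^(d/2-1)`, for `r > 0`. -/
def vmfRadial (d : ℕ) (r : ℝ) : ℝ :=
  Real.Gamma ((d : ℝ) / 2) * (2 : ℝ) ^ ((d : ℝ) / 2 - 1) * besselI ((d : ℝ) / 2 - 1) r /
    r ^ ((d : ℝ) / 2 - 1)

end

/-!
The Gaussian density depends on `x` only through `‖x‖`, so in polar coordinates the standard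
Gaussian law is a product: the direction `U = X / ‖X‖` is uniform on the sphere and independent of
`‖X‖`. Moreover `⟨w, X⟩` has the law of `‖w‖ Y` for a standard real Gaussian `Y`, so the absolute
moments of `⟨w, U⟩` are those of `⟨w, X⟩ = ‖X‖ ⟨w, U⟩` divided by those of `‖X‖`, which are both
Gamma function values. By symmetry of `U` only the even moments contribute to `E exp ⟨w, U⟩`, and by
the duplication formula their exponential series is the Bessel series. The limit at `w = 0` is the
continuity of the moment generating function of the bounded variable `⟨e, U⟩`, `‖e‖ = 1`.
-/

lemma map_withDensity_comp {α β : Type*} [MeasurableSpace α] [MeasurableSpace β] (μ : Measure α)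
    {φ : α → β} (hφ : Measurable φ) {g : β → ENNReal} (hg : Measurable g) :
    (μ.withDensity (g ∘ φ)).map φ = (μ.map φ).withDensity g := by
  ext s hs
  rw [Measure.map_apply hφ hs, withDensity_apply _ (hφ hs), withDensity_apply _ hs,
    setLIntegral_map hs hg hφ, Function.comp_def]

section ProductLaws

variable {Ω α β : Type*} [MeasurableSpace Ω] [MeasurableSpace α] [MeasurableSpace β]
  {P : Measure Ω} [IsProbabilityMeasure P] {X : Ω → α} {Y : Ω → β}
  {σ : Measure α} {ρ : Measure β} [SFinite ρ]

lemma measure_univ_mul_measure_univ_of_map_prodMk (hX : Measurable X) (hY : Measurable Y)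
    (h : P.map (fun ω ↦ (X ω, Y ω)) = σ.prod ρ) : σ Set.univ * ρ Set.univ = 1 := by
  rw [← Measure.prod_prod, Set.univ_prod_univ, ← h, Measure.map_apply (hX.prodMk hY) .univ,
    Set.preimage_univ, measure_univ]

lemma map_fst_of_map_prodMk_eq_prod (hX : Measurable X) (hY : Measurable Y)
    (h : P.map (fun ω ↦ (X ω, Y ω)) = σ.prod ρ) : P.map X = (σ Set.univ)⁻¹ • σ := by
  have hmass := measure_univ_mul_measure_univ_of_map_prodMk hX hY h
  rw [← ENNReal.eq_inv_of_mul_eq_one_left (by rwa [mul_comm]), ← Measure.map_fst_prod, ← h,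
    Measure.map_map measurable_fst (hX.prodMk hY), Function.comp_def]

lemma indepFun_of_map_prodMk_eq_prod (hX : Measurable X) (hY : Measurable Y)
    (h : P.map (fun ω ↦ (X ω, Y ω)) = σ.prod ρ) : IndepFun X Y P := by
  have hmass := measure_univ_mul_measure_univ_of_map_prodMk hX hY h
  have hsnd : P.map Y = σ Set.univ • ρ := by
    rw [← Measure.map_snd_prod, ← h, Measure.map_map measurable_snd (hX.prodMk hY),
      Function.comp_def]
  have hσ : σ Set.univ ≠ 0 := left_ne_zero_of_mul_eq_one hmass
  have hσ' : σ Set.univ ≠ ⊤ := fun htop ↦ by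
    have hρ : ρ Set.univ ≠ 0 := right_ne_zero_of_mul_eq_one hmass
    simp [htop, ENNReal.top_mul hρ] at hmass
  rw [indepFun_iff_map_prod_eq_prod_map_map hX.aemeasurable hY.aemeasurable, h,
    map_fst_of_map_prodMk_eq_prod hX hY h, hsnd, Measure.prod_smul_left, Measure.prod_smul_right,
    smul_smul, ENNReal.inv_mul_cancel hσ hσ', one_smul]

end ProductLaws

local notation "dim" => Module.finrank ℝ

section PolarDecomposition

variable {E : Type*} [NormedAddCommGroup E] [NormedSpace ℝ E]

lemma norm_normalize_le_one (x : E) : ‖NormedSpace.normalize x‖ ≤ 1 := by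
  rcases eq_or_ne x 0 with rfl | hx
  · simp
  · exact (NormedSpace.norm_normalize_eq_one_iff.2 hx).le

variable [MeasurableSpace E]

/-- The uniform probability measure on the unit sphere of a nontrivial finite-dimensional normed
space: the surface measure induced by a Haar measure `μ`, divided by its total mass. -/
noncomputable def sphereUniform (μ : Measure E) : Measure (Metric.sphere (0 : E) 1) :=
  (μ.toSphere Set.univ)⁻¹ • μ.toSphere

variable [BorelSpace E]

lemma measurable_normalize : Measurable (NormedSpace.normalize : E → E) := by
  unfold NormedSpace.normalize
  fun_prop

variable [FiniteDimensional ℝ E] [Nontrivial E] (μ : Measure E) [μ.IsAddHaarMeasure]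

instance isProbabilityMeasure_sphereUniform : IsProbabilityMeasure (sphereUniform μ) :=
  have : NeZero μ.toSphere := ⟨μ.toSphere_ne_zero⟩
  isProbabilityMeasureSMul

lemma map_normalize_norm_addHaar :
    μ.map (fun x ↦ (NormedSpace.normalize x, ‖x‖)) =
      (μ.toSphere.map Subtype.val).prod
        ((Measure.volumeIoiPow (dim E - 1)).map Subtype.val) := by
  have hpolar : Measurable fun x : E ↦ (NormedSpace.normalize x, ‖x‖) :=
    measurable_normalize.prodMk measurable_norm
  have hval : Measurable (Prod.map Subtype.val Subtype.val :
      Metric.sphere (0 : E) 1 × Set.Ioi (0 : ℝ) → E × ℝ) :=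
    measurable_subtype_coe.prodMap measurable_subtype_coe
  calc μ.map (fun x ↦ (NormedSpace.normalize x, ‖x‖))
      = ((μ.comap (Subtype.val : ({0}ᶜ : Set E) → E)).map Subtype.val).map
          fun x ↦ (NormedSpace.normalize x, ‖x‖) := by
        rw [map_comap_subtype_coe (measurableSet_singleton _).compl, restrict_compl_singleton]
    _ = (μ.comap (Subtype.val : ({0}ᶜ : Set E) → E)).map
          (Prod.map Subtype.val Subtype.val ∘ homeomorphUnitSphereProd E) := by
        rw [Measure.map_map hpolar measurable_subtype_coe]
        congr 1 with x <;> simp [NormedSpace.normalize]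
    _ = (μ.toSphere.prod (Measure.volumeIoiPow (dim E - 1))).map
          (Prod.map Subtype.val Subtype.val) := by
        rw [← Measure.map_map hval (homeomorphUnitSphereProd E).measurable,
          μ.measurePreserving_homeomorphUnitSphereProd.map_eq]
    _ = _ := (Measure.map_prod_map _ _ measurable_subtype_coe measurable_subtype_coe).symm

lemma map_normalize_norm_withDensity {f : ℝ → ENNReal} (hf : Measurable f) :
    (μ.withDensity fun x ↦ f ‖x‖).map (fun x ↦ (NormedSpace.normalize x, ‖x‖)) =
      (μ.toSphere.map Subtype.val).prod
        (((Measure.volumeIoiPow (dim E - 1)).map Subtype.val).withDensity f) := by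
  rw [prod_withDensity_right hf, ← map_normalize_norm_addHaar]
  exact map_withDensity_comp μ (g := fun p : E × ℝ ↦ f p.2)
    (measurable_normalize.prodMk measurable_norm) (hf.comp measurable_snd)

variable {μ} {P : Measure E} [IsProbabilityMeasure P] {f : ℝ → ENNReal}

lemma map_normalize_of_eq_withDensity_norm (hf : Measurable f)
    (hP : P = μ.withDensity fun x ↦ f ‖x‖) :
    P.map NormedSpace.normalize = (sphereUniform μ).map Subtype.val := by
  rw [map_fst_of_map_prodMk_eq_prod measurable_normalize measurable_norm
      (hP ▸ map_normalize_norm_withDensity μ hf), Measure.map_apply measurable_subtype_coe .univ,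
    Set.preimage_univ, sphereUniform, Measure.map_smul]

lemma indepFun_normalize_norm_of_eq_withDensity_norm (hf : Measurable f)
    (hP : P = μ.withDensity fun x ↦ f ‖x‖) : IndepFun NormedSpace.normalize norm P :=
  indepFun_of_map_prodMk_eq_prod measurable_normalize measurable_norm
    (hP ▸ map_normalize_norm_withDensity μ hf)

end PolarDecomposition

section NormIntegrals

variable {E : Type*} [NormedAddCommGroup E] [NormedSpace ℝ E] [FiniteDimensional ℝ E]
  [Nontrivial E] [MeasurableSpace E] [BorelSpace E]

lemma integral_norm_rpow_mul_exp_neg_mul_norm_rpow (μ : Measure E) [μ.IsAddHaarMeasure]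
    {p q b : ℝ} (hp : 0 < p) (hq : -(dim E : ℝ) < q) (hb : 0 < b) :
    ∫ x, ‖x‖ ^ q * Real.exp (-b * ‖x‖ ^ p) ∂μ =
      dim E * μ.real (Metric.ball 0 1) *
        (b ^ (-(dim E + q) / p) * (1 / p) *
          Real.Gamma ((dim E + q) / p)) := by
  have hdim : 1 ≤ dim E := Module.finrank_pos
  have hpow : ∀ r ∈ Set.Ioi (0 : ℝ),
      r ^ (dim E - 1) • (r ^ q * Real.exp (-b * r ^ p)) =
        r ^ (dim E - 1 + q) * Real.exp (-b * r ^ p) := fun r hr ↦ by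
    rw [smul_eq_mul, ← mul_assoc, ← Real.rpow_natCast, ← Real.rpow_add hr, Nat.cast_sub hdim,
      Nat.cast_one]
  rw [integral_fun_norm_addHaar μ fun r ↦ r ^ q * Real.exp (-b * r ^ p),
    setIntegral_congr_fun measurableSet_Ioi hpow,
    integral_rpow_mul_exp_neg_mul_rpow hp (by linarith) hb, nsmul_eq_mul, smul_eq_mul, mul_assoc]
  ring_nf

end NormIntegrals

section StdGaussian

/-- The density of the standard Gaussian measure of an `n`-dimensional Euclidean space, as a
function of the norm. -/
noncomputable def gaussianRadialDensity (n : ℕ) (r : ℝ) : ℝ :=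
  (2 * Real.pi) ^ (-(n / 2 : ℝ)) * Real.exp (-(1 / 2) * r ^ 2)

lemma gaussianRadialDensity_nonneg (n : ℕ) (r : ℝ) : 0 ≤ gaussianRadialDensity n r := by
  unfold gaussianRadialDensity
  positivity

lemma continuous_gaussianRadialDensity (n : ℕ) : Continuous (gaussianRadialDensity n) := by
  unfold gaussianRadialDensity
  fun_prop

lemma stdGaussian_real : stdGaussian ℝ = gaussianReal 0 1 := by
  refine Measure.ext_of_charFun (funext fun t ↦ ?_)
  rw [charFun_stdGaussian, charFun_gaussianReal]
  simp [neg_div, ← Complex.ofReal_pow]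

variable {E : Type*} [NormedAddCommGroup E] [InnerProductSpace ℝ E] [FiniteDimensional ℝ E]
  [MeasurableSpace E] [BorelSpace E]

lemma integrable_gaussianRadialDensity_norm :
    Integrable fun x : E ↦ gaussianRadialDensity (dim E) ‖x‖ := by
  refine Integrable.const_mul (Integrable.of_integral_ne_zero ?_) _
  rw [GaussianFourier.integral_rexp_neg_mul_sq_norm (by norm_num)]
  positivity

lemma integral_withDensity_gaussianRadialDensity {F : Type*} [NormedAddCommGroup F]
    [NormedSpace ℝ F] (f : E → F) :
    ∫ x, f x ∂(volume.withDensity fun x : E ↦ ENNReal.ofReal (gaussianRadialDensity (dim E) ‖x‖)) =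
      ∫ x, gaussianRadialDensity (dim E) ‖x‖ • f x := by
  have hmeas : Measurable fun x : E ↦ gaussianRadialDensity (dim E) ‖x‖ :=
    ((continuous_gaussianRadialDensity _).comp continuous_norm).measurable
  rw [integral_withDensity_eq_integral_toReal_smul hmeas.ennreal_ofReal
    (Eventually.of_forall fun _ ↦ ENNReal.ofReal_lt_top)]
  simp only [ENNReal.toReal_ofReal (gaussianRadialDensity_nonneg _ _)]

lemma integral_gaussianRadialDensity_smul_cexp_inner (t : E) :
    ∫ x : E, gaussianRadialDensity (dim E) ‖x‖ • Complex.exp ((inner ℝ t x : ℝ) * Complex.I) =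
      Complex.exp (-‖t‖ ^ 2 / 2) := by
  have hfourier := GaussianFourier.integral_cexp_neg_mul_sq_norm_add (V := E) (b := 1 / 2)
    (by norm_num) Complex.I t
  have hsplit (x : E) :
      gaussianRadialDensity (dim E) ‖x‖ • Complex.exp ((inner ℝ t x : ℝ) * Complex.I) =
        (2 * Real.pi : ℂ) ^ (-(dim E / 2 : ℂ)) *
          Complex.exp (-(1 / 2) * ‖x‖ ^ 2 + Complex.I * (inner ℝ t x : ℝ)) := by
    rw [gaussianRadialDensity, Complex.real_smul, Complex.exp_add, Complex.ofReal_mul,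
      Complex.ofReal_cpow (by positivity), mul_comm Complex.I]
    push_cast
    ring
  have hpi : (2 * Real.pi : ℂ) ≠ 0 := by exact_mod_cast Real.two_pi_pos.ne'
  rw [integral_congr_ae (Eventually.of_forall hsplit), integral_const_mul, hfourier,
    show (Real.pi : ℂ) / (1 / 2) = 2 * Real.pi by ring, ← mul_assoc, ← Complex.cpow_add _ _ hpi,
    neg_add_cancel, Complex.cpow_zero, one_mul, Complex.I_sq]
  ring_nf

lemma stdGaussian_eq_withDensity :
    stdGaussian E =
      volume.withDensity fun x : E ↦ ENNReal.ofReal (gaussianRadialDensity (dim E) ‖x‖) := by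
  have := isFiniteMeasure_withDensity_ofReal (integrable_gaussianRadialDensity_norm (E := E)).2
  refine Measure.ext_of_charFun (funext fun t ↦ ?_)
  rw [charFun_stdGaussian, charFun_apply, integral_withDensity_gaussianRadialDensity]
  simp only [real_inner_comm, integral_gaussianRadialDensity_smul_cexp_inner]

lemma map_inner_stdGaussian (w : E) :
    (stdGaussian E).map (fun x ↦ inner ℝ w x) = (stdGaussian ℝ).map (fun y ↦ ‖w‖ * y) := by
  have hgauss := IsGaussian.map_eq_gaussianReal (μ := stdGaussian E) (innerSL ℝ w)
  rw [integral_strongDual_stdGaussian, variance_dual_stdGaussian, innerSL_apply_norm] at hgauss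
  rw [stdGaussian_real, gaussianReal_map_const_mul]
  refine hgauss.trans ?_
  congr 1
  · rw [mul_zero]
  · ext
    simp

section Nontrivial

variable [Nontrivial E]

lemma map_normalize_stdGaussian :
    (stdGaussian E).map NormedSpace.normalize =
      (sphereUniform (volume : Measure E)).map Subtype.val :=
  map_normalize_of_eq_withDensity_norm
    (continuous_gaussianRadialDensity (dim E)).measurable.ennreal_ofReal stdGaussian_eq_withDensity

lemma indepFun_normalize_norm_stdGaussian :
    IndepFun NormedSpace.normalize norm (stdGaussian E) :=
  indepFun_normalize_norm_of_eq_withDensity_norm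
    (continuous_gaussianRadialDensity (dim E)).measurable.ennreal_ofReal stdGaussian_eq_withDensity

lemma integral_norm_rpow_stdGaussian {q : ℝ} (hq : -(dim E : ℝ) < q) :
    ∫ x, ‖x‖ ^ q ∂stdGaussian E =
      2 ^ (q / 2) * Real.Gamma ((dim E + q) / 2) / Real.Gamma (dim E / 2) := by
  have hdim : (0 : ℝ) < dim E := by exact_mod_cast Module.finrank_pos
  -- The constant need not be evaluated: the total mass, which is the case `s = 0`, determines it.
  obtain ⟨c, hc⟩ : ∃ c : ℝ, ∀ s : ℝ, -(dim E : ℝ) < s →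
      ∫ x, ‖x‖ ^ s ∂stdGaussian E = c * (2 ^ (s / 2) * Real.Gamma ((dim E + s) / 2)) := by
    refine ⟨(2 * Real.pi) ^ (-(dim E / 2 : ℝ)) *
      (dim E * volume.real (Metric.ball (0 : E) 1) * (2 ^ (dim E / 2 : ℝ) / 2)), fun s hs ↦ ?_⟩
    have hint := integral_norm_rpow_mul_exp_neg_mul_norm_rpow (volume : Measure E)
      two_pos hs one_half_pos
    simp only [Real.rpow_two] at hint
    have htwo : (1 / 2 : ℝ) ^ (-(dim E + s) / 2) = 2 ^ (dim E / 2 : ℝ) * 2 ^ (s / 2) := by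
      rw [one_div, Real.inv_rpow two_pos.le, ← Real.rpow_neg two_pos.le, ← Real.rpow_add two_pos]
      ring_nf
    rw [stdGaussian_eq_withDensity, integral_withDensity_gaussianRadialDensity]
    simp only [gaussianRadialDensity, smul_eq_mul, mul_assoc, mul_comm (Real.exp _)]
    rw [integral_const_mul, hint, htwo]
    ring
  have hmass : 1 = c * Real.Gamma (dim E / 2) := by
    simpa using hc 0 (neg_lt_zero.2 hdim)
  rw [hc q hq, eq_div_of_mul_eq (Real.Gamma_pos_of_pos (half_pos hdim)).ne' hmass.symm]
  ring

end Nontrivial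

lemma integral_abs_inner_rpow_stdGaussian (w : E) {q : ℝ} (hq : -1 < q) :
    ∫ x, |inner ℝ w x| ^ q ∂stdGaussian E =
      ‖w‖ ^ q * (2 ^ (q / 2) * Real.Gamma ((1 + q) / 2) / √Real.pi) := by
  have hreal := integral_norm_rpow_stdGaussian (E := ℝ) (q := q)
  simp only [Module.finrank_self, Nat.cast_one, Real.norm_eq_abs, Real.Gamma_one_half_eq] at hreal
  have hmeas : Measurable fun y : ℝ ↦ |y| ^ q := by fun_prop
  rw [← integral_map (φ := fun x ↦ inner ℝ w x) (by fun_prop) hmeas.aestronglyMeasurable,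
    map_inner_stdGaussian, integral_map (by fun_prop) hmeas.aestronglyMeasurable]
  simp only [abs_mul, abs_norm, Real.mul_rpow (norm_nonneg w) (abs_nonneg _)]
  rw [integral_const_mul, hreal hq]

lemma integral_abs_inner_normalize_rpow_stdGaussian [Nontrivial E] (w : E) {q : ℝ} (hq : -1 < q) :
    ∫ x, |inner ℝ w (NormedSpace.normalize x)| ^ q ∂stdGaussian E =
      ‖w‖ ^ q * (Real.Gamma (dim E / 2) * Real.Gamma ((1 + q) / 2) /
        (√Real.pi * Real.Gamma ((dim E + q) / 2))) := by
  have hdim : (1 : ℝ) ≤ dim E := by exact_mod_cast Module.finrank_pos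
  have hG : Real.Gamma ((dim E + q) / 2) ≠ 0 := (Real.Gamma_pos_of_pos (by linarith)).ne'
  have hpolar (x : E) :
      |inner ℝ w (NormedSpace.normalize x)| ^ q * ‖x‖ ^ q = |inner ℝ w x| ^ q := by
    conv_rhs => rw [← NormedSpace.norm_smul_normalize x, inner_smul_right, abs_mul, abs_norm,
      Real.mul_rpow (norm_nonneg x) (abs_nonneg _), mul_comm]
  have hindep : (∫ x, |inner ℝ w (NormedSpace.normalize x)| ^ q ∂stdGaussian E) *
      ∫ x, ‖x‖ ^ q ∂stdGaussian E = ∫ x, |inner ℝ w x| ^ q ∂stdGaussian E := by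
    have hf : Measurable fun u : E ↦ |inner ℝ w u| ^ q := by fun_prop
    have hg : Measurable fun r : ℝ ↦ r ^ q := by fun_prop
    rw [← indepFun_normalize_norm_stdGaussian.integral_fun_comp_mul_comp
      measurable_normalize.aemeasurable measurable_norm.aemeasurable
      hf.aestronglyMeasurable hg.aestronglyMeasurable]
    exact integral_congr_ae (Eventually.of_forall hpolar)
  rw [integral_abs_inner_rpow_stdGaussian w hq,
    integral_norm_rpow_stdGaussian (by linarith)] at hindep
  have hG' : Real.Gamma (dim E / 2) ≠ 0 := (Real.Gamma_pos_of_pos (by linarith)).ne'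
  field_simp at hindep ⊢
  linarith

end StdGaussian

section SymmetricBounded

variable {Ω : Type*} [MeasurableSpace Ω] {P : Measure Ω} {Z : Ω → ℝ} {C : ℝ}

lemma integral_exp_eq_integral_cosh (hsymm : IdentDistrib Z (-Z) P P)
    (hint : Integrable (fun ω ↦ Real.exp (Z ω)) P) :
    ∫ ω, Real.exp (Z ω) ∂P = ∫ ω, Real.cosh (Z ω) ∂P := by
  have hexp : IdentDistrib (fun ω ↦ Real.exp (Z ω)) (fun ω ↦ Real.exp (-Z ω)) P P :=
    hsymm.comp Real.measurable_exp
  simp only [Real.cosh_eq]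
  rw [integral_div, integral_add hint (hexp.integrable_iff.1 hint), ← hexp.integral_eq]
  ring

variable [IsFiniteMeasure P]

lemma hasSum_integral_cosh_of_abs_le (hZ : AEMeasurable Z P) (hC : ∀ᵐ ω ∂P, |Z ω| ≤ C) :
    HasSum (fun k : ℕ ↦ (∫ ω, Z ω ^ (2 * k) ∂P) / (2 * k).factorial)
      (∫ ω, Real.cosh (Z ω) ∂P) := by
  have hbound (k : ℕ) : ∀ᵐ ω ∂P,
      ‖Z ω ^ (2 * k) / (2 * k).factorial‖ ≤ C ^ (2 * k) / (2 * k).factorial := by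
    filter_upwards [hC] with ω hω
    rw [norm_div, norm_pow, RCLike.norm_natCast, Real.norm_eq_abs]
    gcongr
  have hint (k : ℕ) : Integrable (fun ω ↦ Z ω ^ (2 * k) / (2 * k).factorial) P :=
    .of_bound ((hZ.pow_const _).div_const _).aestronglyMeasurable _ (hbound k)
  have hsum : Summable fun k : ℕ ↦ ∫ ω, ‖Z ω ^ (2 * k) / (2 * k).factorial‖ ∂P := by
    refine ((Real.hasSum_cosh C).summable.mul_right (P.real Set.univ)).of_nonneg_of_le
      (fun k ↦ integral_nonneg fun _ ↦ norm_nonneg _) fun k ↦ ?_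
    simpa [mul_comm] using integral_mono_ae (hint k).norm (integrable_const _) (hbound k)
  simpa only [(Real.hasSum_cosh _).tsum_eq, integral_div] using
    hasSum_integral_of_summable_integral_norm hint hsum

lemma hasSum_integral_exp_of_identDistrib_neg (hsymm : IdentDistrib Z (-Z) P P)
    (hC : ∀ᵐ ω ∂P, |Z ω| ≤ C) :
    HasSum (fun k : ℕ ↦ (∫ ω, Z ω ^ (2 * k) ∂P) / (2 * k).factorial)
      (∫ ω, Real.exp (Z ω) ∂P) := by
  have hint : Integrable (fun ω ↦ Real.exp (Z ω)) P := by
    simpa only [one_mul] using integrable_exp_mul_of_mem_Icc (t := 1) hsymm.aemeasurable_fst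
      (hC.mono fun _ ↦ abs_le.1)
  rw [integral_exp_eq_integral_cosh hsymm hint]
  exact hasSum_integral_cosh_of_abs_le hsymm.aemeasurable_fst hC

end SymmetricBounded

section BesselSeries

lemma Gamma_nat_add_half_eq_factorial (k : ℕ) :
    Real.Gamma (k + 1 / 2) = (2 * k).factorial / (4 ^ k * k.factorial) * √Real.pi := by
  have hduplication := Real.Gamma_mul_Gamma_add_half (k + 1 / 2)
  rw [show (k : ℝ) + 1 / 2 + 1 / 2 = k + 1 by ring,
    show 2 * ((k : ℝ) + 1 / 2) = ((2 * k : ℕ) : ℝ) + 1 by push_cast; ring,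
    Real.Gamma_nat_eq_factorial, Real.Gamma_nat_eq_factorial, sub_add_cancel_right,
    Real.rpow_neg two_pos.le, Real.rpow_natCast, pow_mul,
    show (2 : ℝ) ^ 2 = 4 by norm_num] at hduplication
  rw [eq_div_of_mul_eq (by positivity) hduplication]
  field_simp

lemma vmfRadial_eq_tsum (d : ℕ) {r : ℝ} (hr : 0 < r) :
    vmfRadial d r = ∑' k : ℕ, Real.Gamma (d / 2) * (r / 2) ^ (2 * k) /
      (k.factorial * Real.Gamma (k + d / 2)) := by
  rw [vmfRadial, besselI, ← tsum_mul_left, ← tsum_div_const]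
  congr 1 with k
  rw [show (k : ℝ) + (d / 2 - 1) + 1 = k + d / 2 by ring, Real.rpow_add (by positivity),
    Real.div_rpow hr.le two_pos.le (d / 2 - 1 : ℝ),
    show (2 : ℝ) * k = ((2 * k : ℕ) : ℝ) by push_cast; ring, Real.rpow_natCast]
  field_simp

lemma vmfRadial_three {r : ℝ} (hr : 0 < r) : vmfRadial 3 r = Real.sinh r / r := by
  rw [vmfRadial_eq_tsum 3 hr, ← ((Real.hasSum_sinh r).div_const r).tsum_eq]
  congr 1 with k
  have hΓ (m : ℕ) : Real.Gamma (m + (3 : ℕ) / 2) =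
      (m + 1 / 2) * ((2 * m).factorial / (4 ^ m * m.factorial) * √Real.pi) := by
    rw [← Gamma_nat_add_half_eq_factorial, ← Real.Gamma_add_one (by positivity)]
    ring_nf
  have hΓ₀ : Real.Gamma ((3 : ℕ) / 2) = √Real.pi / 2 := by
    simpa [div_eq_inv_mul] using hΓ 0
  rw [hΓ, hΓ₀, Nat.factorial_succ, div_pow, pow_mul 2, pow_succ r, show (2 : ℝ) ^ 2 = 4 by norm_num]
  push_cast
  field_simp

end BesselSeries

section GaussianDirection

variable {E : Type*} [NormedAddCommGroup E] [InnerProductSpace ℝ E]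

lemma abs_inner_normalize_le (w x : E) : |inner ℝ w (NormedSpace.normalize x)| ≤ ‖w‖ :=
  (abs_real_inner_le_norm _ _).trans
    (mul_le_of_le_one_right (norm_nonneg w) (norm_normalize_le_one x))

variable [FiniteDimensional ℝ E] [MeasurableSpace E] [BorelSpace E]

lemma measurable_inner_normalize (w : E) :
    Measurable fun x ↦ inner ℝ w (NormedSpace.normalize x) :=
  measurable_normalize.const_inner

lemma identDistrib_inner_normalize_neg (w : E) :
    IdentDistrib (fun x ↦ inner ℝ w (NormedSpace.normalize x))
      (-fun x ↦ inner ℝ w (NormedSpace.normalize x)) (stdGaussian E) (stdGaussian E) := by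
  have hneg : IdentDistrib id (fun x : E ↦ -x) (stdGaussian E) (stdGaussian E) :=
    ⟨aemeasurable_id, measurable_neg.aemeasurable,
      Measure.map_id.trans (stdGaussian_map (LinearIsometryEquiv.neg ℝ)).symm⟩
  convert! hneg.comp (measurable_inner_normalize w) using 1
  ext x
  simp only [Pi.neg_apply, Function.comp_apply, NormedSpace.normalize_neg, inner_neg_right]

variable [Nontrivial E]

lemma integral_inner_normalize_pow_stdGaussian (w : E) (k : ℕ) :
    ∫ x, (inner ℝ w (NormedSpace.normalize x)) ^ (2 * k) ∂stdGaussian E =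
      (2 * k).factorial * (Real.Gamma (dim E / 2) * (‖w‖ / 2) ^ (2 * k) /
        (k.factorial * Real.Gamma (k + dim E / 2))) := by
  have hmoment := integral_abs_inner_normalize_rpow_stdGaussian w (q := (2 * k : ℕ))
    (by linarith [(2 * k : ℕ).cast_nonneg (α := ℝ)])
  simp only [Real.rpow_natCast, (even_two_mul k).pow_abs] at hmoment
  rw [hmoment, show (1 + ((2 * k : ℕ) : ℝ)) / 2 = k + 1 / 2 by push_cast; ring,
    show (dim E + ((2 * k : ℕ) : ℝ)) / 2 = k + dim E / 2 by push_cast; ring,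
    Gamma_nat_add_half_eq_factorial, div_pow, pow_mul 2,
    show (2 : ℝ) ^ 2 = 4 by norm_num]
  field_simp

lemma hasSum_integral_exp_inner_normalize_stdGaussian (w : E) :
    HasSum (fun k : ℕ ↦ Real.Gamma (dim E / 2) * (‖w‖ / 2) ^ (2 * k) /
        (k.factorial * Real.Gamma (k + dim E / 2)))
      (∫ x, Real.exp (inner ℝ w (NormedSpace.normalize x)) ∂stdGaussian E) := by
  have hsum := hasSum_integral_exp_of_identDistrib_neg (identDistrib_inner_normalize_neg w)
    (Eventually.of_forall (abs_inner_normalize_le w))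
  have hfact (k : ℕ) : ((2 * k).factorial : ℝ) ≠ 0 := by positivity
  simpa only [integral_inner_normalize_pow_stdGaussian, mul_div_cancel_left₀ _ (hfact _)] using hsum

lemma integral_exp_inner_normalize_stdGaussian {w : E} (hw : w ≠ 0) :
    ∫ x, Real.exp (inner ℝ w (NormedSpace.normalize x)) ∂stdGaussian E =
      vmfRadial (dim E) ‖w‖ := by
  rw [vmfRadial_eq_tsum _ (norm_pos_iff.2 hw),
    (hasSum_integral_exp_inner_normalize_stdGaussian w).tsum_eq]

lemma tendsto_vmfRadial_nhdsGT_zero {d : ℕ} [NeZero d] : Tendsto (vmfRadial d) (𝓝[>] 0) (𝓝 1) := by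
  obtain ⟨e, he⟩ := exists_norm_eq (EuclideanSpace ℝ (Fin d)) zero_le_one
  set Z : EuclideanSpace ℝ (Fin d) → ℝ := fun x ↦ inner ℝ e (NormedSpace.normalize x) with hZ
  have hcont : Continuous (mgf Z (stdGaussian _)) :=
    continuous_mgf fun t ↦ integrable_exp_mul_of_mem_Icc
      (measurable_inner_normalize e).aemeasurable
      (Eventually.of_forall fun x ↦ abs_le.1 (abs_inner_normalize_le e x))
  have hmgf : ∀ r ∈ Set.Ioi (0 : ℝ), mgf Z (stdGaussian _) r = vmfRadial d r := fun r hr ↦ by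
    have hre : ‖r • e‖ = r := by rw [norm_smul, he, mul_one, Real.norm_of_nonneg hr.le]
    have hclosed := integral_exp_inner_normalize_stdGaussian (norm_pos_iff.1 (hre ▸ hr))
    simpa only [mgf, hZ, real_inner_smul_left, hre, finrank_euclideanSpace_fin] using hclosed
  rw [← mgf_zero (X := Z) (μ := stdGaussian _)]
  exact (hcont.tendsto 0 |>.mono_left nhdsWithin_le_nhds).congr'
    (eventually_nhdsWithin_of_forall hmgf)

end GaussianDirection

section Kernel

variable {X : Type*} {d : ℕ}

lemma nnkIntegrand_exp (t : X → EuclideanSpace ℝ (Fin d)) (θi θj : NeuronParam d) (x : X) :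
    nnkIntegrand Real.exp t θi θj x =
      Real.exp (θi.2 + θj.2) * Real.exp (inner ℝ (θi.1 + θj.1) (t x)) := by
  rw [nnkIntegrand, ← Real.exp_add, ← Real.exp_add, inner_add_left]
  ring_nf

variable [MeasurableSpace X] {μ : Measure X} {t : X → EuclideanSpace ℝ (Fin d)} {σ : ℝ → ℝ}

lemma nnKernel_exp (t : X → EuclideanSpace ℝ (Fin d)) (θi θj : NeuronParam d) :
    nnKernel Real.exp t μ θi θj =
      Real.exp (θi.2 + θj.2) * ∫ x, Real.exp (inner ℝ (θi.1 + θj.1) (t x)) ∂μ := by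
  simp only [nnKernel, nnkIntegrand_exp, integral_const_mul]

lemma nnKernel_id_map (hσ : Measurable σ) (ht : AEMeasurable t μ) (θi θj : NeuronParam d) :
    nnKernel σ id (μ.map t) θi θj = nnKernel σ t μ θi θj := by
  have hmeas : Measurable (nnkIntegrand σ (id : EuclideanSpace ℝ (Fin d) → _) θi θj) := by
    unfold nnkIntegrand
    fun_prop
  exact integral_map ht hmeas.aestronglyMeasurable

lemma integrable_nnkIntegrand_of_norm_le [IsFiniteMeasure μ] (hσ : Continuous σ)
    (ht : AEMeasurable t μ) {C : ℝ} (hC : ∀ᵐ x ∂μ, ‖t x‖ ≤ C) (θi θj : NeuronParam d) :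
    Integrable (nnkIntegrand σ t θi θj) μ := by
  have hcont : Continuous (nnkIntegrand σ (id : EuclideanSpace ℝ (Fin d) → _) θi θj) := by
    unfold nnkIntegrand
    fun_prop
  obtain ⟨M, hM⟩ := (isCompact_closedBall 0 C).exists_bound_of_continuousOn hcont.continuousOn
  exact .of_bound (hcont.measurable.comp_aemeasurable ht).aestronglyMeasurable M
    (hC.mono fun x hx ↦ hM (t x) (mem_closedBall_zero_iff.2 hx))

lemma nnKernel_exp_sphereProj_eq_vmfRadial [NeZero d] (θi θj : NeuronParam d)
    (hw : θi.1 + θj.1 ≠ 0) :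
    nnKernel Real.exp (sphereProj d) (stdGaussian (EuclideanSpace ℝ (Fin d))) θi θj =
      Real.exp (θi.2 + θj.2) * vmfRadial d ‖θi.1 + θj.1‖ := by
  have hclosed := integral_exp_inner_normalize_stdGaussian hw
  rw [finrank_euclideanSpace_fin] at hclosed
  rw [nnKernel_exp, ← hclosed]
  rfl

lemma map_sphereProj_stdGaussian [NeZero d] :
    (stdGaussian (EuclideanSpace ℝ (Fin d))).map (sphereProj d) =
      (uniformSphere d).map Subtype.val :=
  map_normalize_stdGaussian

end Kernel

theorem mainTheorem10 :
    (∀ d : ℕ, 1 ≤ d →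
      -- the law of `x / ‖x‖` for a standard Gaussian `x` is the uniform measure on the sphere
      (stdGaussian (EuclideanSpace ℝ (Fin d))).map (sphereProj d) =
        (uniformSphere d).map Subtype.val ∧
      ∀ θi θj : NeuronParam d,
        -- both kernels are given by convergent integrals, and they agree
        Integrable (nnkIntegrand Real.exp (sphereProj d) θi θj)
          (stdGaussian (EuclideanSpace ℝ (Fin d))) ∧
        Integrable (nnkIntegrand Real.exp Subtype.val θi θj) (uniformSphere d) ∧
        nnKernel Real.exp (sphereProj d) (stdGaussian (EuclideanSpace ℝ (Fin d))) θi θj =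
          nnKernel Real.exp Subtype.val (uniformSphere d) θi θj ∧
        -- closed form
        (θi.1 + θj.1 ≠ 0 →
          nnKernel Real.exp (sphereProj d) (stdGaussian (EuclideanSpace ℝ (Fin d))) θi θj =
            Real.exp (θi.2 + θj.2) * vmfRadial d ‖θi.1 + θj.1‖) ∧
        -- at `w_i + w_j = 0` the closed form is read as its limit, which is `exp (b_i + b_j)`
        (θi.1 + θj.1 = 0 →
          nnKernel Real.exp (sphereProj d) (stdGaussian (EuclideanSpace ℝ (Fin d))) θi θj =
            Real.exp (θi.2 + θj.2) ∧
          Tendsto (fun r : ℝ => Real.exp (θi.2 + θj.2) * vmfRadial d r) (𝓝[>] 0)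
            (𝓝 (Real.exp (θi.2 + θj.2))))) ∧
    -- the case `d = 3`
    (∀ θi θj : NeuronParam 3, θi.1 + θj.1 ≠ 0 →
      nnKernel Real.exp (sphereProj 3) (stdGaussian (EuclideanSpace ℝ (Fin 3))) θi θj =
        Real.exp (θi.2 + θj.2) * (Real.sinh ‖θi.1 + θj.1‖ / ‖θi.1 + θj.1‖)) := by
  refine ⟨fun d hd ↦ ?_, fun θi θj hw ↦ ?_⟩
  · have : NeZero d := ⟨by lia⟩
    have hproj : Measurable (sphereProj d) := measurable_normalize
    have : IsProbabilityMeasure (uniformSphere d) := isProbabilityMeasure_sphereUniform volume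
    refine ⟨map_sphereProj_stdGaussian, fun θi θj ↦ ⟨?_, ?_, ?_, fun hw ↦ ?_, fun hw ↦ ⟨?_, ?_⟩⟩⟩
    · exact integrable_nnkIntegrand_of_norm_le Real.continuous_exp hproj.aemeasurable
        (Eventually.of_forall norm_normalize_le_one) θi θj
    · exact integrable_nnkIntegrand_of_norm_le Real.continuous_exp
        measurable_subtype_coe.aemeasurable
        (Eventually.of_forall fun u ↦ (norm_eq_of_mem_sphere u).le) θi θj
    · rw [← nnKernel_id_map Real.measurable_exp hproj.aemeasurable, map_sphereProj_stdGaussian,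
        nnKernel_id_map Real.measurable_exp measurable_subtype_coe.aemeasurable]
    · exact nnKernel_exp_sphereProj_eq_vmfRadial θi θj hw
    · simp [nnKernel_exp, hw]
    · simpa only [mul_one] using tendsto_vmfRadial_nhdsGT_zero.const_mul (Real.exp (θi.2 + θj.2))
  · rw [nnKernel_exp_sphereProj_eq_vmfRadial θi θj hw, vmfRadial_three (norm_pos_iff.2 hw)]
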